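/- Let $\theta$ be a finite signature with function symbols only (constants allowed as $0$-ary symbols). Let $\mathcal A=\langle A,\theta\rangle$ be an algebra of signature $\theta$ whose carrier $A$ is a Hausdorff uniform space with uniformity $\mathcal W$, such that all operations are continuous and $A$ is uniformly locally compact: there is $W\in\mathcal W$ such that for every $x\in A$ the set $W(x)=\{y\in A: (x,y)\in W\}$ has compact closure. Let $\mathcal K$ be a class of finite algebras of signature $\theta$. For a compact set $C\subseteq A$ and $W\in\mathcal W$, a pair $(\mathcal A_f,j)$ of a finite algebra $\mathcal A_f$ of signature $\theta$ with carrier $A_f$ and a map $j:A_f\to A$ is a $(C,W)$-approximation of $\mathcal A$ if (i) for every $c\in C$ there is $m\in j(A_f)$ with $(c,m)\in W$; and (ii) for every $n$-ary $g\in\theta$, with interpretation $g_f$ in $\mathcal A_f$, and every $\bar a\in A_f^n$ such that $j(\bar a)\in C^n$ and $g(j(\bar a))\in C$, one has $(g(j(\bar a)),\,j(g_f(\bar a)))\in W$. Assume that $\mathcal A$ is approximable by finite $\mathcal K$-algebras: for every compact $C\subseteq A$ and every $W\in\mathcal W$ such that $\overline{W(x)}$ is compact for all $x\in A$, there is a $(C,W)$-approximation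 $(\mathcal A_f,j)$ of $\mathcal A$ with $\mathcal A_f\in\mathcal K$. Let $\lambda$ be the weight of the topology of $A$, i.e. the least cardinality of a base (with $\lambda=\aleph_0$ if the weight is finite). For an ultrafilter $U$ on a set $I$ and sets $X_i$ $(i\in I)$, a subset of $\prod_i X_i/U$ is internal if it is of the form $\prod_i T_i/U$ with $T_i\subseteq X_i$, i.e. it consists of the classes of those $(a_i)_i$ for which $\{i: a_i\in T_i\}\in U$; internal subsets of $(\prod_i X_i/U)^2$ are defined in the same way from sets $T_i\subseteq X_i^2$. A $\sigma$-set (respectively, a $\pi$-set) is a union (respectively, an intersection) of at most $\lambda$ internal sets. Then there are an ultrafilter $U$ on a set $I$ and algebras $\mathcal B_i\in\mathcal K$ $(i\in I)$ such that, with $\mathcal B=\prod_{i}\mathcal B_i/U$ and $B$ its carrier: 1. $U$ yields $\lambda^+$-saturated ultraproducts: for all sets $X_i$ $(i\in I)$, every family of at most $\lambda$ internal subsets of $\prod_i X_i/U$ with the finite intersection property has nonempty intersection. In particular $\mathcal B$ is $\lambda^+$-saturated in this sense. 2. There are a subalgebra $\mathcal B_\sigma$ of $\mathcal B$ whose carrier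 is a $\sigma$-set, and an equivalence relation $\rho$ on $B$ that is a $\pi$-set in $B^2$, such that $\rho\upharpoonright\mathcal B_\sigma$ is a congruence relation on $\mathcal B_\sigma$ and $\mathcal A$ is isomorphic, as an algebra of signature $\theta$, to the quotient algebra $\mathcal B_\sigma/\rho$. -/

import Mathlib

open Cardinal
open scoped FirstOrder

universe u v v' w

namespace FinApprox

/-! ### Uniformly locally compact spaces and weight -/

/-- Some entourage `W` has all its sections `W(x) = {y | (x, y) ∈ W}` relatively compact. -/
def UniformlyLocallyCompact (A : Type u) [UniformSpace A] : Prop :=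
  ∃ W ∈ uniformity A, ∀ x : A, IsCompact (closure {y : A | (x, y) ∈ W})

/-- The weight of a topology: the least cardinality of a base. -/
noncomputable def topWeight (A : Type u) [TopologicalSpace A] : Cardinal.{u} :=
  sInf {κ : Cardinal.{u} | ∃ 𝓑 : Set (Set A), TopologicalSpace.IsTopologicalBasis 𝓑 ∧ #𝓑 = κ}

/-- The infinite cardinal `λ` attached to a space: its weight (or `ℵ₀` if the weight is finite). -/
noncomputable def lambda (A : Type u) [TopologicalSpace A] : Cardinal.{u} :=
  max ℵ₀ (topWeight A)

/-! ### Approximation by finite algebras -/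

section Approximation

variable (L : FirstOrder.Language.{v, v'}) {A : Type u} [L.Structure A]

/-- Every point of `C` is `W`-close to a point of `S`. -/
def IsGrid (C : Set A) (W : Set (A × A)) (S : Set A) : Prop :=
  ∀ c ∈ C, ∃ m ∈ S, (c, m) ∈ W

/-- `j` commutes with the operations up to `W`, whenever arguments and value lie in `C`. -/
def IsApproxHom (C : Set A) (W : Set (A × A)) {M : Type w} [L.Structure M] (j : M → A) : Prop :=
  ∀ (n : ℕ) (g : L.Functions n) (a : Fin n → M),
    (∀ i, j (a i) ∈ C) → FirstOrder.Language.Structure.funMap g (fun i => j (a i)) ∈ C →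
      (FirstOrder.Language.Structure.funMap g (fun i => j (a i)),
        j (FirstOrder.Language.Structure.funMap g a)) ∈ W

/-- `(M, j)` is a `(C, W)`-approximation of `A`. -/
def IsApproximation (C : Set A) (W : Set (A × A)) {M : Type w} [L.Structure M]
    (j : M → A) : Prop :=
  IsApproxHom L C W j ∧ IsGrid C W (Set.range j)

variable (A)

/-- `A` is approximable by algebras of the class `K`. -/
def IsApproximable [UniformSpace A] (K : Set (CategoryTheory.Bundled.{w} L.Structure)) : Prop :=
  ∀ C : Set A, IsCompact C →
    ∀ W ∈ uniformity A, (∀ x : A, IsCompact (closure {y : A | (x, y) ∈ W})) →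
      ∃ M ∈ K, ∃ j : M → A, IsApproximation L C W j

end Approximation

/-! ### Internal sets, `σ`-sets, `π`-sets and saturation for ultraproducts -/

section Internal

variable {ι : Type u} (U : Ultrafilter ι) (X : ι → Type w)

/-- The ultraproduct `∏ X i / U`. -/
abbrev UProd : Type (max u w) := (U : Filter ι).Product X

variable {X}

/-- The class in the ultraproduct of an element of the product. -/
def cls (a : ∀ i, X i) : UProd U X := Quotient.mk _ a

/-- `S` is internal: it is itself the ultraproduct of a family of subsets `T i ⊆ X i`. -/
def IsInternal (S : Set (UProd U X)) : Prop :=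
  ∃ T : ∀ i, Set (X i), ∀ a : ∀ i, X i, cls U a ∈ S ↔ ∀ᶠ i in U, a i ∈ T i

/-- `R` is an internal set of pairs: the ultraproduct of a family of sets `T i ⊆ X i × X i`. -/
def IsInternalRel (R : Set (UProd U X × UProd U X)) : Prop :=
  ∃ T : ∀ i, Set (X i × X i), ∀ a b : ∀ i, X i,
    (cls U a, cls U b) ∈ R ↔ ∀ᶠ i in U, (a i, b i) ∈ T i

/-- `σ`-set: a union of at most `κ` internal sets. -/
def IsSigmaSet (κ : Cardinal.{u}) (S : Set (UProd U X)) : Prop :=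
  ∃ (J : Type u) (F : J → Set (UProd U X)),
    #J ≤ κ ∧ (∀ j, IsInternal U (F j)) ∧ S = ⋃ j, F j

/-- `π`-relation: an intersection of at most `κ` internal sets of pairs. -/
def IsPiRel (κ : Cardinal.{u}) (R : Set (UProd U X × UProd U X)) : Prop :=
  ∃ (J : Type u) (F : J → Set (UProd U X × UProd U X)),
    #J ≤ κ ∧ (∀ j, IsInternalRel U (F j)) ∧ R = ⋂ j, F j

variable (X)

/-- `∏ X i / U` is `κ⁺`-saturated: a family of at most `κ` internal subsets with the finite
intersection property has nonempty intersection. -/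
def IsSaturated (κ : Cardinal.{u}) : Prop :=
  ∀ (J : Type u) (F : J → Set (UProd U X)), #J ≤ κ → (∀ j, IsInternal U (F j)) →
    (∀ s : Finset J, (⋂ j ∈ s, F j).Nonempty) → (⋂ j, F j).Nonempty

end Internal

/-! ### Congruences and quotient algebras -/

section Congruence

variable (L : FirstOrder.Language.{v, v'}) {N : Type w} [L.Structure N]

/-- The equivalence relation `s` is a congruence: it is respected by all operations. -/
def IsCongruence (s : Setoid N) : Prop :=
  ∀ (n : ℕ) (f : L.Functions n) (x y : Fin n → N), (∀ i, s (x i) (y i)) →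
    s (FirstOrder.Language.Structure.funMap f x) (FirstOrder.Language.Structure.funMap f y)

variable {L}

/-- The quotient algebra of `N` by a congruence. -/
def QuotientAlgebra {s : Setoid N} (_h : IsCongruence L s) : Type w := Quotient s

/-- The class of an element in the quotient algebra. -/
def QuotientAlgebra.mk {s : Setoid N} (h : IsCongruence L s) (x : N) : QuotientAlgebra h :=
  Quotient.mk s x

/-- A congruence on an algebra (no relation symbols) as a prestructure. -/
abbrev IsCongruence.prestructure [L.IsAlgebraic] {s : Setoid N} (h : IsCongruence L s) :
    L.Prestructure s where
  toStructure := inferInstance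
  fun_equiv x y hxy := h _ _ x y hxy
  rel_equiv {_ r} _ _ _ := isEmptyElim r

/-- Operations of the quotient algebra, computed on representatives. -/
instance [L.IsAlgebraic] {s : Setoid N} (h : IsCongruence L s) :
    L.Structure (QuotientAlgebra h) :=
  @FirstOrder.Language.quotientStructure L N s h.prestructure

/-- The operations of the quotient algebra are the induced ones. -/
theorem funMap_quotientAlgebra [L.IsAlgebraic] {s : Setoid N} (h : IsCongruence L s) {n : ℕ}
    (f : L.Functions n) (x : Fin n → N) :
    FirstOrder.Language.Structure.funMap f (fun i => QuotientAlgebra.mk h (x i)) =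
      QuotientAlgebra.mk h (FirstOrder.Language.Structure.funMap f x) :=
  @FirstOrder.Language.funMap_quotient_mk' L N s h.prestructure n f x

end Congruence

end FinApprox

/-! The algebra is recovered by taking standard parts in an ultraproduct of ever finer
approximations.

By `exists_small_entourages` and `exists_small_compacts`, `λ` entourages determine the topology and
`λ` compact sets have interiors covering `A`. Let `U` be regular: finite sets `q i` of labels
eventually contain any given label. At index `i`, choose an approximation for the finitely many
compact sets and entourages labelled by `q i`. An element of the ultraproduct represented by `b` has
standard part `a` if `j i (b i)` tends to `a` along `U`. The elements with a standard part form
`B_σ`; by compactness they are exactly those eventually in one of the chosen compact sets, hence a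
`σ`-set. Infinitesimal closeness for the chosen entourages is the `π`-relation `ρ`. The standard
part map is a homomorphism (`HasStandardPart.funMap`), onto `A` (`exists_hasStandardPart`), with
kernel `ρ` on `B_σ` (`infinitesimalSetoid_iff`).

Saturation requires more than regularity, namely a good ultrafilter. It is built in
`exists_good_ultrafilter` by a transfinite recursion of length `2 ^ λ` that spends finitely many
functions of an independent family at each step. -/

namespace FinApprox

open Filter Set
open scoped Uniformity Topology SetRel

/-! ### Good ultrafilters from independent families -/

section Independent

variable {ι Γ E D : Type*}

/-- The points at which the functions `f γ`, `γ ∈ s`, take the values `v γ`. -/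
def cylinder (f : Γ → ι → E) (s : Finset Γ) (v : Γ → E) : Set ι :=
  {i | ∀ γ ∈ s, f γ i = v γ}

/-- The functions `f γ`, `γ ∈ G`, are independent modulo the filter `F`. -/
def IndepMod (F : Filter ι) (f : Γ → ι → E) (G : Set Γ) : Prop :=
  ∀ s : Finset Γ, ↑s ⊆ G → ∀ v : Γ → E, (F ⊓ 𝓟 (cylinder f s v)).NeBot

/-- `F` excludes that all the sets `P s` are large, or there is `q : ι → Finset D`, eventually
containing each given `d`, with `i ∈ P (q i)` eventually. -/
def Settles (F : Filter ι) (P : Finset D → Set ι) : Prop :=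
  Disjoint F (⨅ s, 𝓟 (P s)) ∨
    ∃ q : ι → Finset D, (∀ d, ∀ᶠ i in F, d ∈ q i) ∧ ∀ᶠ i in F, i ∈ P (q i)

theorem Settles.mono {F F' : Filter ι} {P : Finset D → Set ι} (h : Settles F P) (hF : F' ≤ F) :
    Settles F' P := by
  rcases h with h | ⟨q, hq, hP⟩
  · exact .inl (h.mono_left hF)
  · exact .inr ⟨q, fun d => hF (hq d), hF hP⟩

theorem IndepMod.mono {F : Filter ι} {f : Γ → ι → E} {G G' : Set Γ} (h : IndepMod F f G)
    (hG : G' ⊆ G) : IndepMod F f G' :=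
  fun s hs => h s (hs.trans hG)

/-- Prescriptions of values on `s` and on a finite set disjoint from `s` merge into a single
prescription. -/
theorem IndepMod.inf_cylinder {F : Filter ι} {f : Γ → ι → E} {G : Set Γ} (h : IndepMod F f G)
    {s : Finset Γ} (hs : ↑s ⊆ G) (v : Γ → E) :
    IndepMod (F ⊓ 𝓟 (cylinder f s v)) f (G \ s) := by
  classical
  intro t ht w
  refine (h (s ∪ t) ?_ fun γ => if γ ∈ s then v γ else w γ).mono ?_
  · intro γ hγ
    rcases Finset.mem_union.1 (Finset.mem_coe.1 hγ) with h1 | h1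
    · exact hs h1
    · exact (ht h1).1
  · rw [inf_assoc, inf_principal]
    refine inf_le_inf_left _ (principal_mono.2 fun i hi => ⟨fun γ hγ => ?_, fun γ hγ => ?_⟩)
    · simpa [hγ] using hi γ (Finset.mem_union_left _ hγ)
    · have : γ ∉ s := (ht hγ).2
      simpa [this] using hi γ (Finset.mem_union_right _ hγ)

/-- If all the sets `P s` are in `F`, one of the independent functions can be used as `q`. -/
theorem IndepMod.exists_settles_of_mem {F : Filter ι} {f : Γ → ι → Finset D} {G : Set Γ}
    (h : IndepMod F f G) {g : Γ} (hg : g ∈ G) {P : Finset D → Set ι} (hP : ∀ s, P s ∈ F) :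
    ∃ F' ≤ F, IndepMod F' f (G \ {g}) ∧ Settles F' P := by
  classical
  -- The function `f g` is made to serve as `q`. Independence of the others survives because `f g`
  -- may still be prescribed to equal `s`, and there the added condition reduces to `i ∈ P s`, which
  -- holds on a set of `F`.
  let Q : Finset D → Filter ι := fun s => F ⊓ 𝓟 {i | s ⊆ f g i ∧ i ∈ P (f g i)}
  have hQ : ∀ s, (⨅ s, Q s) ≤ 𝓟 {i | s ⊆ f g i ∧ i ∈ P (f g i)} := fun s =>
    (iInf_le _ s).trans inf_le_right
  refine ⟨⨅ s, Q s, (iInf_le _ ∅).trans inf_le_left, fun t ht v => ?_,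
    .inr ⟨f g, fun d => ?_, ?_⟩⟩
  · rw [iInf_inf]
    refine iInf_neBot_of_directed' ?_ fun s => ?_
    · refine directed_of_isDirected_le fun s s' hs => ?_
      exact inf_le_inf_right _ (inf_le_inf_left _ (principal_mono.2 fun i hi =>
        ⟨hs.trans hi.1, hi.2⟩))
    · have hgt : g ∉ t := fun hgt => (ht hgt).2 rfl
      refine (h (insert g t) ?_ (Function.update v g s)).mono ?_
      · intro γ hγ
        rcases Finset.mem_insert.1 (Finset.mem_coe.1 hγ) with rfl | h1
        · exact hg
        · exact (ht h1).1
      · have hle : F ⊓ 𝓟 (cylinder f (insert g t) (Function.update v g s)) ≤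
            F ⊓ 𝓟 (P s ∩ cylinder f (insert g t) (Function.update v g s)) := by
          rw [← inf_principal, ← inf_assoc, inf_eq_left.2 (le_principal_iff.2 (hP s))]
        refine hle.trans ?_
        rw [inf_assoc, inf_principal]
        refine inf_le_inf_left _ (principal_mono.2 ?_)
        rintro i ⟨hi, hc⟩
        have hgi : f g i = s := by simpa using hc g (Finset.mem_insert_self _ _)
        refine ⟨⟨hgi.ge, by rwa [hgi]⟩, fun γ hγ => ?_⟩
        have hne : γ ≠ g := fun h => hgt (h ▸ hγ)
        simpa [hne] using hc γ (Finset.mem_insert_of_mem hγ)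
  · exact mem_of_superset (le_principal_iff.1 (hQ {d})) fun i hi =>
      hi.1 (Finset.mem_singleton_self d)
  · exact mem_of_superset (le_principal_iff.1 (hQ ∅)) fun i hi => hi.2

/-- Every `P` is settled at the cost of finitely many of the independent functions. -/
theorem IndepMod.exists_settles {F : Filter ι} {f : Γ → ι → Finset D} {G : Set Γ}
    (h : IndepMod F f G) (hG : G.Nonempty) (P : Finset D → Set ι) :
    ∃ F' ≤ F, ∃ s : Finset Γ, IndepMod F' f (G \ s) ∧ Settles F' P := by
  -- Either all the sets `P s` can be added without destroying independence, or some cylinder is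
  -- incompatible with them; adding that cylinder to `F` then excludes them for good.
  by_cases hP : IndepMod (F ⊓ ⨅ s, 𝓟 (P s)) f G
  · obtain ⟨g, hg⟩ := hG
    obtain ⟨F', hF', hi, hs⟩ := hP.exists_settles_of_mem hg (P := P) fun s =>
      mem_inf_of_right (mem_iInf_of_mem s (mem_principal_self _))
    exact ⟨F', hF'.trans inf_le_left, {g}, by simpa using hi, hs⟩
  · simp only [IndepMod, not_forall, not_neBot] at hP
    obtain ⟨s, hs, v, hbot⟩ := hP
    refine ⟨F ⊓ 𝓟 (cylinder f s v), inf_le_left, s, h.inf_cylinder hs v, .inl ?_⟩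
    rw [disjoint_iff, inf_right_comm, hbot]

end Independent

/-- Fewer than `#Γ` finite subsets do not cover an uncountable `Γ`. -/
theorem nonempty_compl_iUnion_finset {Γ B : Type u} (hΓ : ℵ₀ < #Γ) (hB : #B < #Γ)
    (s : B → Finset Γ) : (⋃ b, (s b : Set Γ))ᶜ.Nonempty := by
  rw [nonempty_compl]
  intro h
  have h1 : #(⋃ b, (s b : Set Γ)) < #Γ := by
    refine (mk_iUnion_le_sum_mk).trans_lt ?_
    refine (sum_le_sum _ (fun _ => ℵ₀) fun b => (lt_aleph0_of_finite _).le).trans_lt ?_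
    rw [sum_const']
    exact mul_lt_of_lt hΓ.le hB hΓ
  rw [h, mk_univ] at h1
  exact h1.false

/-- All members of a family of length `Γ` can be settled at once. -/
theorem IndepMod.exists_settles_all {ι D : Type*} {Γ : Type u} [LinearOrder Γ]
    [WellFoundedLT Γ] (hΓ₀ : ℵ₀ < #Γ) (hΓ : ∀ γ : Γ, #(Iio γ) < #Γ) {f : Γ → ι → Finset D}
    (h : IndepMod ⊤ f univ) (P : Γ → Finset D → Set ι) :
    ∃ F : Filter ι, F.NeBot ∧ ∀ γ, Settles F (P γ) := by
  have hstep : ∀ (F : Filter ι) (G : Set Γ) (γ : Γ), ∃ p : Filter ι × Finset Γ,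
      IndepMod F f G → G.Nonempty →
        p.1 ≤ F ∧ IndepMod p.1 f (G \ p.2) ∧ Settles p.1 (P γ) := by
    intro F G γ
    by_cases hF : IndepMod F f G ∧ G.Nonempty
    · obtain ⟨F', h1, s, h2⟩ := hF.1.exists_settles hF.2 (P γ)
      exact ⟨(F', s), fun _ _ => ⟨h1, h2⟩⟩
    -- Junk value, never reached: `key` shows that independence and nonemptiness persist at every
    -- stage.
    · exact ⟨(F, ∅), fun h1 h2 => absurd ⟨h1, h2⟩ hF⟩
  choose step hstep using hstep
  let X : Γ → Filter ι × Finset Γ := (wellFounded_lt (α := Γ)).fix fun γ r =>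
    step (⨅ β : Iio γ, (r β.1 β.2).1) (⋃ β : Iio γ, ((r β.1 β.2).2 : Set Γ))ᶜ γ
  have hX : ∀ γ, X γ = step (⨅ β : Iio γ, (X β).1) (⋃ β : Iio γ, ((X β).2 : Set Γ))ᶜ γ :=
    fun γ => WellFounded.fix_eq _ _ γ
  have key : ∀ γ, (X γ).1 ≤ ⨅ β : Iio γ, (X β).1 ∧
      IndepMod (X γ).1 f ((⋃ β : Iio γ, ((X β).2 : Set Γ))ᶜ \ (X γ).2) ∧
      Settles (X γ).1 (P γ) := by
    intro γ
    induction γ using WellFoundedLT.induction with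
    | ind γ ih =>
      -- Independence has finite character and the earlier filters decrease, so it passes to their
      -- infimum.
      have hind : IndepMod (⨅ β : Iio γ, (X β).1) f (⋃ β : Iio γ, ((X β).2 : Set Γ))ᶜ := by
        rcases isEmpty_or_nonempty (Iio γ) with he | he
        · rw [iInf_of_empty]
          exact h.mono (subset_univ _)
        · intro s hs v
          rw [iInf_inf]
          refine iInf_neBot_of_directed' ?_ fun β => ?_
          · refine directed_of_isDirected_le fun β β' hβ => inf_le_inf_right _ ?_
            rcases hβ.eq_or_lt with rfl | hlt
            · exact le_rfl
            · exact (ih β' β'.2).1.trans (iInf_le (fun b : Iio β'.1 => (X b).1) ⟨β.1, hlt⟩)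
          · refine (ih β β.2).2.1 s (fun δ hδ => ?_) v
            have h1 := hs hδ
            simp only [mem_compl_iff, mem_iUnion, not_exists, Subtype.forall, mem_Iio] at h1
            refine ⟨?_, h1 β.1 β.2⟩
            simp only [mem_compl_iff, mem_iUnion, not_exists, Subtype.forall, mem_Iio]
            exact fun b hb => h1 b (hb.trans β.2)
      have hne := nonempty_compl_iUnion_finset hΓ₀ (hΓ γ) fun β : Iio γ => (X β).2
      have := hstep _ _ γ hind hne
      rwa [← hX γ] at this
  have hanti : Antitone fun γ => (X γ).1 := by
    intro β γ hβ
    rcases hβ.eq_or_lt with rfl | hlt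
    · exact le_rfl
    · exact (key γ).1.trans (iInf_le (fun b : Iio γ => (X b).1) ⟨β, hlt⟩)
  have : Nonempty Γ := mk_ne_zero_iff.1 (aleph0_pos.trans hΓ₀).ne'
  refine ⟨⨅ γ, (X γ).1, iInf_neBot_of_directed' hanti.directed_ge fun γ => ?_, fun γ =>
    (key γ).2.2.mono (iInf_le _ γ)⟩
  exact ((key γ).2.1 ∅ (by simp) fun _ => ∅).mono inf_le_left

open Classical in
/-- A family of functions on `Finset D × Finset (Finset D × Finset D)`, indexed by `Set D`: the
finite set of pairs is read as a partial function, evaluated at the trace of `S` on the first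
component. -/
noncomputable def traceFun {D : Type u} (S : Set D)
    (i : Finset D × Finset (Finset D × Finset D)) : Finset D :=
  (i.2.filter fun p => p.1 = i.1.filter (· ∈ S)).biUnion Prod.snd

theorem exists_finset_separating {D : Type u} [Nonempty D] (s : Finset (Set D)) :
    ∃ F : Finset D, ∀ S ∈ s, ∀ T ∈ s, (∀ d ∈ F, d ∈ S ↔ d ∈ T) → S = T := by
  classical
  have : ∀ S T : Set D, ∃ d : D, S ≠ T → ¬(d ∈ S ↔ d ∈ T) := by
    intro S T
    by_cases h : S = T
    · exact ⟨Classical.arbitrary D, fun h' => absurd h h'⟩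
    · by_contra! hc
      exact h (Set.ext fun d => (hc d).2)
  choose d hd using this
  refine ⟨(s ×ˢ s).image fun p => d p.1 p.2, fun S hS T hT h => ?_⟩
  by_contra hne
  exact hd S T hne (h _ (Finset.mem_image.2 ⟨(S, T), Finset.mk_mem_product hS hT, rfl⟩))

/-- If `F` separates the members of `s`, their traces on `F` are distinct, so the table pairing each
trace with the prescribed value is single-valued and its lookup returns `v S`. -/
theorem indepMod_traceFun (D : Type u) [Nonempty D] :
    IndepMod ⊤ (traceFun (D := D)) univ := by
  classical
  intro s _ v
  rw [top_inf_eq, principal_neBot_iff]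
  obtain ⟨F, hF⟩ := exists_finset_separating s
  refine ⟨(F, s.image fun S => (F.filter (· ∈ S), v S)), fun S hS => ?_⟩
  ext d
  simp only [traceFun, Finset.mem_biUnion, Finset.mem_filter, Finset.mem_image]
  constructor
  · rintro ⟨_, ⟨⟨T, hT, rfl⟩, h⟩, hd⟩
    have : T = S := hF T hT S hS fun e he => by
      simpa [he] using Finset.ext_iff.1 h e
    exact this ▸ hd
  · exact fun hd => ⟨_, ⟨⟨S, hS, rfl⟩, by ext; simp⟩, hd⟩

/-- Existence of a good countably incomplete ultrafilter, in the form in which it is used. -/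
theorem exists_good_ultrafilter (D : Type u) [Infinite D] :
    ∃ (ι : Type u) (U : Ultrafilter ι), ∀ P : Finset D → Set ι, (∀ s, ∀ᶠ i in U, i ∈ P s) →
      ∃ q : ι → Finset D, (∀ d, ∀ᶠ i in U, d ∈ q i) ∧ ∀ᶠ i in U, i ∈ P (q i) := by
  let ι := Finset D × Finset (Finset D × Finset D)
  let Γ := (#(Set D)).ord.ToType
  have hD : ℵ₀ ≤ #D := aleph0_le_mk D
  have hι : #ι = #D := by
    simp only [ι, mk_prod, lift_id, mk_finset_of_infinite, mul_eq_self hD]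
  have hΓD : #Γ = #(Set D) := by simp [Γ]
  -- There are only `2 ^ #D` families `P`, so a recursion along the initial ordinal `Γ` settles all
  -- of them, while each stage has fewer than `#Γ` predecessors.
  have hT : #(Finset D → Set ι) = #Γ := by
    rw [hΓD, ← power_def, mk_set, mk_set, hι, mk_finset_of_infinite, ← power_mul, mul_eq_self hD]
  obtain ⟨e⟩ := Cardinal.eq.1 hΓD
  obtain ⟨t⟩ := Cardinal.eq.1 hT.symm
  have hΓ₀ : ℵ₀ < #Γ := by
    rw [hΓD, mk_set]
    exact hD.trans_lt (cantor _)
  have hind : IndepMod ⊤ (fun γ => traceFun (e γ)) univ := by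
    classical
    intro s _ v
    refine (indepMod_traceFun D (s.map e.toEmbedding) (subset_univ _) (v ∘ e.symm)).mono ?_
    refine inf_le_inf_left _ (principal_mono.2 fun i hi γ hγ => ?_)
    simpa using hi (e γ) (Finset.mem_map_of_mem _ hγ)
  obtain ⟨F, hF, hs⟩ := hind.exists_settles_all hΓ₀
    (fun γ => mk_Iio_lt γ (by simp [Γ])) t
  refine ⟨ι, Ultrafilter.of F, fun P hP => ?_⟩
  have hset := (hs (t.symm P)).mono (Ultrafilter.of_le F)
  rw [t.apply_symm_apply] at hset
  refine hset.resolve_left fun hdis => ?_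
  have hle : (Ultrafilter.of F : Filter ι) ≤ ⨅ s, 𝓟 (P s) :=
    le_iInf fun s => le_principal_iff.2 (hP s)
  exact (Ultrafilter.of F).neBot.ne (hdis.eq_bot_of_le hle)

/-- Let `P s` be the set of indices at which the sets labelled by `s` have a common point. For the
resulting `q`, choosing at `i` a common point of those labelled by `q i` gives an element of every
set of the family, as each label is eventually in `q i`. -/
theorem isSaturated_of_good {ι D : Type u} {U : Ultrafilter ι}
    (hU : ∀ P : Finset D → Set ι, (∀ s, ∀ᶠ i in U, i ∈ P s) →
      ∃ q : ι → Finset D, (∀ d, ∀ᶠ i in U, d ∈ q i) ∧ ∀ᶠ i in U, i ∈ P (q i))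
    (X : ι → Type w) : IsSaturated U X #D := by
  classical
  intro J F hJ hF hfip
  obtain ⟨e⟩ := Cardinal.le_def _ _ |>.1 hJ
  choose T hT using hF
  have hpre : ∀ s : Finset D, ∀ j, j ∈ s.preimage e e.injective.injOn ↔ e j ∈ s :=
    fun s j => Finset.mem_preimage
  obtain ⟨q, hq, hP⟩ := hU (fun s => {i | (⋂ j ∈ s.preimage e e.injective.injOn, T j i).Nonempty})
    fun s => by
      obtain ⟨x, hx⟩ := hfip (s.preimage e e.injective.injOn)
      induction x using Quotient.inductionOn with | _ a
      have : ∀ᶠ i in U, ∀ j ∈ s.preimage e e.injective.injOn, a i ∈ T j i :=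
        (Finset.eventually_all _).2 fun j hj => (hT j a).1 (mem_iInter₂.1 hx j hj)
      exact this.mono fun i hi => ⟨a i, mem_iInter₂.2 hi⟩
  obtain ⟨x, -⟩ := hfip ∅
  induction x using Quotient.inductionOn with | _ a
  let b : ∀ i, X i := fun i =>
    if h : (⋂ j ∈ (q i).preimage e e.injective.injOn, T j i).Nonempty then h.some else a i
  refine ⟨cls U b, mem_iInter.2 fun j => (hT j b).2 ?_⟩
  filter_upwards [hP, hq (e j)] with i hi hj
  have hb : b i = Set.Nonempty.some hi := dif_pos hi
  rw [hb]
  exact mem_iInter₂.1 (Set.Nonempty.some_mem hi) j ((hpre _ _).2 hj)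

/-! ### Small families of entourages and of compact sets -/

section Topological

theorem exists_basis_card_le (A : Type u) [TopologicalSpace A] :
    ∃ 𝓑 : Set (Set A), TopologicalSpace.IsTopologicalBasis 𝓑 ∧ #𝓑 ≤ lambda A := by
  have hne : {κ : Cardinal.{u} | ∃ 𝓑 : Set (Set A),
      TopologicalSpace.IsTopologicalBasis 𝓑 ∧ #𝓑 = κ}.Nonempty :=
    ⟨_, _, TopologicalSpace.isTopologicalBasis_opens, rfl⟩
  obtain ⟨𝓑, h𝓑, hc⟩ := csInf_mem hne
  exact ⟨𝓑, h𝓑, hc.le.trans (le_max_right _ _)⟩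

/-- A sequence of symmetric entourages inside `V`, each containing the square of the next one. -/
theorem exists_entourage_seq {A : Type u} [UniformSpace A] {V : Set (A × A)} (hV : V ∈ 𝓤 A) :
    ∃ W : ℕ → SetRel A A, W 0 ⊆ V ∧ (∀ n, W n ∈ 𝓤 A) ∧ (∀ n, (W n).IsSymm) ∧
      ∀ n, W (n + 1) ○ W (n + 1) ⊆ W n := by
  have h : ∀ s : {s : SetRel A A // s ∈ 𝓤 A}, ∃ t : {s : SetRel A A // s ∈ 𝓤 A},
      t.1.IsSymm ∧ t.1 ○ t.1 ⊆ s.1 := fun s => by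
    obtain ⟨t, h1, h2, h3⟩ := comp_symm_mem_uniformity_sets s.2
    exact ⟨⟨t, h1⟩, h2, h3⟩
  choose next hsymm hcomp using h
  let W : ℕ → {s : SetRel A A // s ∈ 𝓤 A} := fun n => Nat.rec (next ⟨V, hV⟩) (fun _ s => next s) n
  refine ⟨fun n => (W n).1, ?_, fun n => (W n).2, fun n => ?_, fun n => hcomp _⟩
  · exact (subset_comp_self_of_mem_uniformity (W 0).2).trans (hcomp ⟨V, hV⟩)
  · cases n
    · exact hsymm _
    · exact hsymm _

/-- At most `λ` entourages generate a uniformity with the given topology. -/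
theorem exists_small_entourages (A : Type u) [UniformSpace A] :
    ∃ (J : Type u) (W : J → SetRel A A), #J ≤ lambda A ∧ (∀ j, W j ∈ 𝓤 A) ∧
      (∀ j, (W j).IsSymm) ∧ (∀ j, ∃ k, W k ○ W k ⊆ W j) ∧
      ∀ a : A, ∀ N ∈ 𝓝 a, ∃ j, {y | (a, y) ∈ W j} ⊆ N := by
  obtain ⟨𝓑, h𝓑, hc⟩ := exists_basis_card_le A
  -- For each pair of basic sets, keep one entourage carrying the first into the second, if there is
  -- any. Such pairs suffice for neighbourhoods: shrink the first set to an `S`-small one, with `S ○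
  -- S` small enough to stay in the second.
  have hV : ∀ p : 𝓑 × 𝓑, ∃ V ∈ 𝓤 A, (∃ V' ∈ 𝓤 A, ∀ x ∈ p.1.1, ∀ y, (x, y) ∈ V' → y ∈ p.2.1) →
      ∀ x ∈ p.1.1, ∀ y, (x, y) ∈ V → y ∈ p.2.1 := by
    intro p
    by_cases h : ∃ V' ∈ 𝓤 A, ∀ x ∈ p.1.1, ∀ y, (x, y) ∈ V' → y ∈ p.2.1
    · obtain ⟨V, h1, h2⟩ := h
      exact ⟨V, h1, fun _ => h2⟩
    · exact ⟨univ, univ_mem, fun h' => absurd h' h⟩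
  choose V hV𝓤 hV using hV
  choose W hW0 hW𝓤 hWs hWc using fun p => exists_entourage_seq (hV𝓤 p)
  refine ⟨(𝓑 × 𝓑) × ULift.{u} ℕ, fun j => W j.1 j.2.down, ?_, fun j => hW𝓤 _ _,
    fun j => hWs _ _, fun j => ⟨(j.1, ⟨j.2.down + 1⟩), hWc _ _⟩, fun a N hN => ?_⟩
  · have hl : ℵ₀ ≤ lambda A := le_max_left _ _
    simp only [mk_prod, lift_id, mk_uLift, mk_nat, lift_aleph0]
    exact mul_le_of_le hl (mul_le_of_le hl hc hc) hl
  · obtain ⟨B₂, hB₂, ha₂, hB₂N⟩ := h𝓑.mem_nhds_iff.1 hN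
    obtain ⟨T, hT, hTB⟩ := UniformSpace.mem_nhds_iff.1 (h𝓑.mem_nhds hB₂ ha₂)
    obtain ⟨S, hS, hST⟩ := comp_mem_uniformity_sets hT
    obtain ⟨B₁, hB₁, ha₁, hB₁S⟩ := h𝓑.mem_nhds_iff.1 (UniformSpace.ball_mem_nhds a hS)
    refine ⟨((⟨B₁, hB₁⟩, ⟨B₂, hB₂⟩), ⟨0⟩), fun y hy => hB₂N ?_⟩
    refine hV (⟨B₁, hB₁⟩, ⟨B₂, hB₂⟩) ⟨S, hS, fun x hx z hz => ?_⟩ a ha₁ y (hW0 _ hy)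
    exact hTB (hST ⟨x, hB₁S hx, hz⟩)

/-- In a uniformly locally compact space there are `λ` compact sets whose interiors cover. -/
theorem exists_small_compacts {A : Type u} [UniformSpace A] (hA : UniformlyLocallyCompact A) :
    ∃ (J : Type u) (C : J → Set A), #J ≤ lambda A ∧ (∀ j, IsCompact (C j)) ∧
      ∀ a : A, ∃ j, C j ∈ 𝓝 a := by
  obtain ⟨𝓑, h𝓑, hc⟩ := exists_basis_card_le A
  refine ⟨{B : 𝓑 // IsCompact (closure B.1)}, fun B => closure B.1.1,
    (mk_subtype_le _).trans hc, fun B => B.2, fun a => ?_⟩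
  obtain ⟨W, hW, hWc⟩ := hA
  obtain ⟨B, hB, ha, hBW⟩ := h𝓑.mem_nhds_iff.1 (UniformSpace.ball_mem_nhds a hW)
  exact ⟨⟨⟨B, hB⟩, (hWc a).of_isClosed_subset isClosed_closure (closure_mono hBW)⟩,
    mem_of_superset (h𝓑.mem_nhds hB ha) subset_closure⟩

variable {A ι J : Type*} [UniformSpace A] {W : J → SetRel A A}

/-- The `W j` need not generate the given uniformity; it is enough that they detect neighbourhoods
of points and can be halved. -/
theorem tendsto_of_eventually_mem (hW : ∀ j, W j ∈ 𝓤 A) (hcomp : ∀ j, ∃ k, W k ○ W k ⊆ W j)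
    (hnhds : ∀ a : A, ∀ N ∈ 𝓝 a, ∃ j, {y | (a, y) ∈ W j} ⊆ N) {l : Filter ι} {x y : ι → A}
    {a : A} (hx : Tendsto x l (𝓝 a)) (hxy : ∀ j, ∀ᶠ i in l, (x i, y i) ∈ W j) :
    Tendsto y l (𝓝 a) := by
  intro N hN
  change ∀ᶠ i in l, y i ∈ N
  obtain ⟨j, hj⟩ := hnhds a N hN
  obtain ⟨k, hk⟩ := hcomp j
  filter_upwards [hx (UniformSpace.ball_mem_nhds a (hW k)), hxy k] with i h1 h2
  exact hj (hk ⟨x i, h1, h2⟩)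

theorem eventually_mem_of_tendsto {l : Filter ι} {x y : ι → A} {a : A}
    (hx : Tendsto x l (𝓝 a)) (hy : Tendsto y l (𝓝 a)) {V : Set (A × A)} (hV : V ∈ 𝓤 A) :
    ∀ᶠ i in l, (x i, y i) ∈ V :=
  (hx.prodMk_nhds hy) (nhds_le_uniformity a hV)

end Topological

/-! ### Quotients by kernels and internal sets -/

theorem isCongruence_of_hom {L : FirstOrder.Language.{v, v'}} {N : Type w} {A : Type u}
    [L.Structure N] [L.Structure A] (φ : N →[L] A) {s : Setoid N}
    (hs : ∀ x y, s x y ↔ φ x = φ y) : IsCongruence L s := by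
  intro n f x y hxy
  rw [hs, φ.map_fun, φ.map_fun]
  congr 1
  exact funext fun i => (hs _ _).1 (hxy i)

theorem nonempty_equiv_quotientAlgebra {L : FirstOrder.Language.{v, v'}} [L.IsAlgebraic]
    {N : Type w} {A : Type u} [L.Structure N] [L.Structure A] (φ : N →[L] A)
    (hφ : Function.Surjective φ) {s : Setoid N} (h : IsCongruence L s)
    (hs : ∀ x y, s x y ↔ φ x = φ y) : Nonempty (A ≃[L] QuotientAlgebra h) := by
  let e : QuotientAlgebra h → A := Quotient.lift φ fun x y hxy => (hs x y).1 hxy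
  have he : Function.Bijective e := by
    constructor
    · intro x y hxy
      induction x using Quotient.inductionOn
      induction y using Quotient.inductionOn
      exact Quotient.sound ((hs _ _).2 hxy)
    · intro a
      obtain ⟨x, rfl⟩ := hφ a
      exact ⟨QuotientAlgebra.mk h x, rfl⟩
  let E : QuotientAlgebra h ≃[L] A :=
    { Equiv.ofBijective e he with
      map_fun' := by
        intro n f x
        choose r hr using fun i => Quotient.exists_rep (x i)
        obtain rfl : (fun i => QuotientAlgebra.mk h (r i)) = x := funext hr
        rw [funMap_quotientAlgebra]
        exact φ.map_fun f r
      map_rel' := fun r => isEmptyElim r }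
  exact ⟨E.symm⟩

section InternalSets

variable {ι : Type u} (U : Ultrafilter ι) {X : ι → Type w}

theorem cls_surjective : Function.Surjective (cls U (X := X)) :=
  Quotient.exists_rep

theorem cls_eq_cls {a b : ∀ i, X i} : cls U a = cls U b ↔ ∀ᶠ i in U, a i = b i :=
  Quotient.eq

/-- The ultraproduct of a family of subsets. -/
def internalSet (T : ∀ i, Set (X i)) : Set (UProd U X) :=
  {x | ∃ a, cls U a = x ∧ ∀ᶠ i in U, a i ∈ T i}

/-- The ultraproduct of a family of relations. -/
def internalRel (T : ∀ i, Set (X i × X i)) : Set (UProd U X × UProd U X) :=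
  {x | ∃ a b, (cls U a, cls U b) = x ∧ ∀ᶠ i in U, (a i, b i) ∈ T i}

theorem cls_mem_internalSet {T : ∀ i, Set (X i)} {a : ∀ i, X i} :
    cls U a ∈ internalSet U T ↔ ∀ᶠ i in U, a i ∈ T i := by
  refine ⟨?_, fun h => ⟨a, rfl, h⟩⟩
  rintro ⟨b, hb, h⟩
  filter_upwards [(cls_eq_cls U).1 hb, h] with i h1 h2
  rwa [← h1]

theorem cls_mem_internalRel {T : ∀ i, Set (X i × X i)} {a b : ∀ i, X i} :
    (cls U a, cls U b) ∈ internalRel U T ↔ ∀ᶠ i in U, (a i, b i) ∈ T i := by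
  refine ⟨?_, fun h => ⟨a, b, rfl, h⟩⟩
  rintro ⟨a', b', h', h⟩
  obtain ⟨ha, hb⟩ := Prod.mk.inj h'
  filter_upwards [(cls_eq_cls U).1 ha, (cls_eq_cls U).1 hb, h] with i h1 h2 h3
  rwa [← h1, ← h2]

theorem isInternal_internalSet (T : ∀ i, Set (X i)) : IsInternal U (internalSet U T) :=
  ⟨T, fun _ => cls_mem_internalSet U⟩

theorem isInternalRel_internalRel (T : ∀ i, Set (X i × X i)) :
    IsInternalRel U (internalRel U T) :=
  ⟨T, fun _ _ => cls_mem_internalRel U⟩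

end InternalSets

/-! ### Standard parts -/

section StandardPart

variable {A ι : Type u} {U : Ultrafilter ι} {M : ι → Type w}

/-- The images of `x` in `A` converge to `a` along `U`. -/
def HasStandardPart [TopologicalSpace A] (j : ∀ i, M i → A) (x : UProd U M) (a : A) : Prop :=
  ∃ b, cls U b = x ∧ Tendsto (fun i => j i (b i)) U (𝓝 a)

theorem hasStandardPart_cls [TopologicalSpace A] {j : ∀ i, M i → A} {b : ∀ i, M i} {a : A} :
    HasStandardPart j (cls U b) a ↔ Tendsto (fun i => j i (b i)) U (𝓝 a) := by
  refine ⟨?_, fun h => ⟨b, rfl, h⟩⟩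
  rintro ⟨b', hb', h⟩
  refine h.congr' ?_
  filter_upwards [(cls_eq_cls U).1 hb'] with i hi
  rw [hi]

theorem HasStandardPart.unique [TopologicalSpace A] [T2Space A] {j : ∀ i, M i → A}
    {x : UProd U M} {a a' : A} (h : HasStandardPart j x a) (h' : HasStandardPart j x a') :
    a = a' := by
  obtain ⟨b, rfl⟩ := cls_surjective U x
  exact tendsto_nhds_unique (hasStandardPart_cls.1 h) (hasStandardPart_cls.1 h')

/-- The elements with a standard part form the union of the ultraproducts of the preimages of
compact sets whose interiors cover. -/
theorem setOf_hasStandardPart_eq [TopologicalSpace A] {J : Type*} {C : J → Set A}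
    (hC : ∀ k, IsCompact (C k)) (hcov : ∀ a : A, ∃ k, C k ∈ 𝓝 a) (j : ∀ i, M i → A) :
    {x : UProd U M | ∃ a, HasStandardPart j x a} =
      ⋃ k, internalSet U fun i => j i ⁻¹' C k := by
  ext x
  obtain ⟨b, rfl⟩ := cls_surjective U x
  rw [mem_iUnion]
  constructor
  · rintro ⟨a, ha⟩
    obtain ⟨k, hk⟩ := hcov a
    exact ⟨k, (cls_mem_internalSet U).2 (hasStandardPart_cls.1 ha hk)⟩
  · rintro ⟨k, hk⟩
    have hk' : ∀ᶠ i in U, j i (b i) ∈ C k :=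
      (cls_mem_internalSet (T := fun i => j i ⁻¹' C k) U).1 hk
    obtain ⟨a, -, ha⟩ := (hC k).ultrafilter_le_nhds (U.map fun i => j i (b i))
      (le_principal_iff.2 hk')
    exact ⟨a, hasStandardPart_cls.2 ha⟩

/-- Infinitesimal closeness with respect to the entourages `W k`. -/
def infinitesimalSetoid [UniformSpace A] {J : Type*} {W : J → SetRel A A} (hW : ∀ k, W k ∈ 𝓤 A)
    (hsymm : ∀ k, (W k).IsSymm) (hcomp : ∀ k, ∃ l, W l ○ W l ⊆ W k) (j : ∀ i, M i → A) :
    Setoid (UProd U M) where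
  r x y := ∀ k, (x, y) ∈ internalRel U fun i => {p | (j i p.1, j i p.2) ∈ W k}
  iseqv := by
    constructor
    · intro x k
      obtain ⟨b, rfl⟩ := cls_surjective U x
      exact (cls_mem_internalRel U).2 (.of_forall fun i =>
        refl_mem_uniformity (x := j i (b i)) (hW k))
    · intro x y h k
      obtain ⟨b, rfl⟩ := cls_surjective U x
      obtain ⟨c, rfl⟩ := cls_surjective U y
      exact (cls_mem_internalRel U).2 (((cls_mem_internalRel U).1 (h k)).mono fun i hi =>
        (hsymm k).symm _ _ hi)
    · intro x y z hxy hyz k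
      obtain ⟨l, hl⟩ := hcomp k
      obtain ⟨b, rfl⟩ := cls_surjective U x
      obtain ⟨c, rfl⟩ := cls_surjective U y
      obtain ⟨d, rfl⟩ := cls_surjective U z
      refine (cls_mem_internalRel U).2 ?_
      filter_upwards [(cls_mem_internalRel U).1 (hxy l), (cls_mem_internalRel U).1 (hyz l)]
        with i h1 h2
      exact hl ⟨_, h1, h2⟩

theorem isPiRel_infinitesimalSetoid [UniformSpace A] {J : Type u} {W : J → SetRel A A}
    (hW : ∀ k, W k ∈ 𝓤 A) (hsymm : ∀ k, (W k).IsSymm) (hcomp : ∀ k, ∃ l, W l ○ W l ⊆ W k)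
    (j : ∀ i, M i → A) {κ : Cardinal.{u}} (hJ : #J ≤ κ) :
    IsPiRel U κ {p | infinitesimalSetoid (U := U) hW hsymm hcomp j p.1 p.2} := by
  refine ⟨J, fun k => internalRel U fun i => {p | (j i p.1, j i p.2) ∈ W k}, hJ,
    fun k => isInternalRel_internalRel U _, ?_⟩
  ext p
  simp only [mem_iInter]
  exact Iff.rfl

theorem infinitesimalSetoid_iff [UniformSpace A] [T2Space A] {J : Type*} {W : J → SetRel A A}
    (hW : ∀ k, W k ∈ 𝓤 A) (hsymm : ∀ k, (W k).IsSymm) (hcomp : ∀ k, ∃ l, W l ○ W l ⊆ W k)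
    (hnhds : ∀ a : A, ∀ N ∈ 𝓝 a, ∃ k, {y | (a, y) ∈ W k} ⊆ N) {j : ∀ i, M i → A}
    {x y : UProd U M} {a a' : A} (hx : HasStandardPart j x a) (hy : HasStandardPart j y a') :
    infinitesimalSetoid (U := U) hW hsymm hcomp j x y ↔ a = a' := by
  obtain ⟨b, rfl⟩ := cls_surjective U x
  obtain ⟨c, rfl⟩ := cls_surjective U y
  have hb := hasStandardPart_cls.1 hx
  have hc := hasStandardPart_cls.1 hy
  constructor
  · intro h
    have hbc : ∀ k, ∀ᶠ i in U, (j i (b i), j i (c i)) ∈ W k := fun k =>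
      (cls_mem_internalRel (T := fun i => {p | (j i p.1, j i p.2) ∈ W k}) U).1 (h k)
    exact tendsto_nhds_unique (tendsto_of_eventually_mem hW hcomp hnhds hb hbc) hc
  · rintro rfl k
    exact (cls_mem_internalRel U).2 (eventually_mem_of_tendsto hb hc (hW k))

end StandardPart

/-! ### The ultraproduct of finer and finer approximations -/

section Ultraproduct

variable {L : FirstOrder.Language.{v, v'}} {A ι : Type u} [UniformSpace A] [L.Structure A]
  {U : Ultrafilter ι} {M : ι → Type w} [∀ i, L.Structure (M i)] {J J' : Type*}
  {W : J → SetRel A A} {C : J' → Set A} {V : ι → Set (A × A)} {D : ι → Set A} {j : ∀ i, M i → A}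

theorem HasStandardPart.funMap
    (hcont : ∀ (n : ℕ) (f : L.Functions n),
      Continuous (fun x : Fin n → A => FirstOrder.Language.Structure.funMap f x))
    (hW : ∀ k, W k ∈ 𝓤 A) (hcomp : ∀ k, ∃ l, W l ○ W l ⊆ W k)
    (hnhds : ∀ a : A, ∀ N ∈ 𝓝 a, ∃ k, {y | (a, y) ∈ W k} ⊆ N)
    (hcov : ∀ a : A, ∃ k, C k ∈ 𝓝 a) (hj : ∀ i, IsApproxHom L (D i) (V i) (j i))
    (hV : ∀ k, ∀ᶠ i in U, V i ⊆ W k) (hD : ∀ k, ∀ᶠ i in U, C k ⊆ D i)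
    {n : ℕ} (f : L.Functions n) {x : Fin n → UProd U M} {a : Fin n → A}
    (hx : ∀ m, HasStandardPart j (x m) (a m)) :
    HasStandardPart j (FirstOrder.Language.Structure.funMap f x)
      (FirstOrder.Language.Structure.funMap f a) := by
  choose b hb hlim using hx
  obtain rfl : (fun m => cls U (b m)) = x := funext hb
  have hfun : FirstOrder.Language.Structure.funMap f (fun m => cls U (b m)) =
      cls U fun i => FirstOrder.Language.Structure.funMap f fun m => b m i :=
    FirstOrder.Language.Ultraproduct.funMap_cast f b
  -- The homomorphism condition only speaks of arguments and values in `D i`; convergent families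
  -- enter it because `D i` eventually contains a compact neighbourhood of the limit.
  have hmem : ∀ {y : ι → A} {c : A}, Tendsto y U (𝓝 c) → ∀ᶠ i in U, y i ∈ D i := by
    intro y c hy
    obtain ⟨k, hk⟩ := hcov c
    filter_upwards [hy hk, hD k] with i h1 h2
    exact h2 h1
  have hlimf : Tendsto (fun i => FirstOrder.Language.Structure.funMap f fun m => j i (b m i)) U
      (𝓝 (FirstOrder.Language.Structure.funMap f a)) :=
    ((hcont n f).tendsto a).comp (tendsto_pi_nhds.2 hlim)
  rw [hfun, hasStandardPart_cls]
  refine tendsto_of_eventually_mem hW hcomp hnhds hlimf fun k => ?_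
  filter_upwards [eventually_all.2 fun m => hmem (hlim m), hmem hlimf, hV k] with i h1 h2 h3
  exact h3 (hj i n f (fun m => b m i) h1 h2)

theorem exists_hasStandardPart
    (hW : ∀ k, W k ∈ 𝓤 A) (hcomp : ∀ k, ∃ l, W l ○ W l ⊆ W k)
    (hnhds : ∀ a : A, ∀ N ∈ 𝓝 a, ∃ k, {y | (a, y) ∈ W k} ⊆ N)
    (hcov : ∀ a : A, ∃ k, C k ∈ 𝓝 a) (hj : ∀ i, IsGrid (D i) (V i) (range (j i)))
    (hne : Nonempty A → ∀ i, (D i).Nonempty)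
    (hV : ∀ k, ∀ᶠ i in U, V i ⊆ W k) (hD : ∀ k, ∀ᶠ i in U, C k ⊆ D i) (a : A) :
    ∃ x : UProd U M, HasStandardPart j x a := by
  have h : ∀ i, ∃ b : M i, a ∈ D i → (a, j i b) ∈ V i := by
    intro i
    by_cases ha : a ∈ D i
    · obtain ⟨_, ⟨b, rfl⟩, hb⟩ := hj i a ha
      exact ⟨b, fun _ => hb⟩
    -- Where `a` is not yet in `D i`, any element of `M i` will do; one exists because the grid
    -- condition is applied to a nonempty `D i`.
    · obtain ⟨c, hc⟩ := hne ⟨a⟩ i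
      obtain ⟨_, ⟨b, rfl⟩, -⟩ := hj i c hc
      exact ⟨b, fun h' => absurd h' ha⟩
  choose b hb using h
  refine ⟨cls U b, hasStandardPart_cls.2 ?_⟩
  refine tendsto_of_eventually_mem hW hcomp hnhds tendsto_const_nhds fun k => ?_
  obtain ⟨l, hl⟩ := hcov a
  filter_upwards [hV k, hD l] with i h1 h2
  exact h1 (hb i (h2 (mem_of_mem_nhds hl)))

end Ultraproduct

/-- The approximations indexed by a good ultrafilter become eventually finer than `λ` given
entourages and compact sets. -/
theorem exists_approximations {L : FirstOrder.Language.{v, v'}} {A : Type u} [UniformSpace A]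
    [L.Structure A] (hA : UniformlyLocallyCompact A)
    {K : Set (CategoryTheory.Bundled.{w} L.Structure)} (happrox : IsApproximable L A K)
    {E ι J J' : Type u} {U : Ultrafilter ι} {q : ι → Finset E} (hq : ∀ d, ∀ᶠ i in U, d ∈ q i)
    (hJ : #J ≤ #E) (hJ' : #J' ≤ #E) {W : J → SetRel A A} (hW : ∀ k, W k ∈ 𝓤 A)
    {C : J' → Set A} (hC : ∀ k, IsCompact (C k)) :
    ∃ (M : ι → CategoryTheory.Bundled.{w} L.Structure) (j : ∀ i, M i → A)
      (D : ι → Set A) (V : ι → Set (A × A)), (∀ i, M i ∈ K) ∧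
        (∀ i, IsApproximation L (D i) (V i) (j i)) ∧ (Nonempty A → ∀ i, (D i).Nonempty) ∧
        (∀ k, ∀ᶠ i in U, V i ⊆ W k) ∧ ∀ k, ∀ᶠ i in U, C k ⊆ D i := by
  obtain ⟨e⟩ := (Cardinal.le_def _ _).1 hJ
  obtain ⟨e'⟩ := (Cardinal.le_def _ _).1 hJ'
  obtain ⟨W₀, hW₀, hW₀c⟩ := hA
  obtain ⟨S, hS, hSne⟩ : ∃ S : Set A, IsCompact S ∧ (Nonempty A → S.Nonempty) := by
    rcases isEmpty_or_nonempty A with h | ⟨⟨a⟩⟩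
    · exact ⟨∅, isCompact_empty, fun h' => absurd h' (not_nonempty_iff.2 h)⟩
    · exact ⟨{a}, isCompact_singleton, fun _ => singleton_nonempty a⟩
  let D : ι → Set A := fun i => S ∪ ⋃ k ∈ e' ⁻¹' (q i), C k
  -- Intersecting with `W₀` keeps the sections relatively compact, as approximability requires;
  -- finiteness of `q i` makes `V i` an entourage and `D i` compact.
  let V : ι → Set (A × A) := fun i => W₀ ∩ ⋂ k ∈ e ⁻¹' (q i), W k
  have hfin : ∀ i, (e ⁻¹' (q i : Set E)).Finite := fun i =>
    (q i).finite_toSet.preimage e.injective.injOn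
  have hfin' : ∀ i, (e' ⁻¹' (q i : Set E)).Finite := fun i =>
    (q i).finite_toSet.preimage e'.injective.injOn
  have hD : ∀ i, IsCompact (D i) := fun i =>
    hS.union ((hfin' i).isCompact_biUnion fun k _ => hC k)
  have hV : ∀ i, V i ∈ 𝓤 A := fun i =>
    inter_mem hW₀ ((biInter_mem (hfin i)).2 fun k _ => hW k)
  have hVc : ∀ i x, IsCompact (closure {y | (x, y) ∈ V i}) := fun i x =>
    (hW₀c x).of_isClosed_subset isClosed_closure (closure_mono fun y hy => hy.1)
  choose M hM j hj using fun i => happrox (D i) (hD i) (V i) (hV i) (hVc i)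
  refine ⟨M, j, D, V, hM, hj, fun h i => (hSne h).mono subset_union_left, fun k => ?_,
    fun k => ?_⟩
  · filter_upwards [hq (e k)] with i hi
    exact inter_subset_right.trans (biInter_subset_of_mem hi)
  · filter_upwards [hq (e' k)] with i hi
    exact (subset_biUnion_of_mem (u := C) (show k ∈ e' ⁻¹' (q i : Set E) from hi)).trans
      subset_union_right

end FinApprox

theorem mainTheorem8
    (L : FirstOrder.Language.{v, v'}) [L.IsAlgebraic] [Finite L.Symbols]
    (A : Type u) [UniformSpace A] [T2Space A] [L.Structure A]
    (hA : FinApprox.UniformlyLocallyCompact A)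
    (hcont : ∀ (n : ℕ) (f : L.Functions n),
      Continuous (fun x : Fin n → A => FirstOrder.Language.Structure.funMap f x))
    (K : Set (CategoryTheory.Bundled.{w} L.Structure))
    (hK : ∀ M ∈ K, Finite M)
    (happrox : FinApprox.IsApproximable L A K) :
    ∃ (ι : Type u) (U : Ultrafilter ι) (M : ι → CategoryTheory.Bundled.{w} L.Structure),
      (∀ i, M i ∈ K) ∧
      -- the ultrapower by `U` of the universe is saturated, in particular `∏ M i / U` is
      (∀ X : ι → Type w, FinApprox.IsSaturated U X (FinApprox.lambda A)) ∧
      ∃ (Bσ : L.Substructure (FinApprox.UProd U (fun i => M i)))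
        (ρ : Setoid (FinApprox.UProd U (fun i => M i))),
        FinApprox.IsSigmaSet U (FinApprox.lambda A)
          (Bσ : Set (FinApprox.UProd U (fun i => M i))) ∧
        FinApprox.IsPiRel U (FinApprox.lambda A) {p | ρ p.1 p.2} ∧
        ∃ h : FinApprox.IsCongruence L (ρ.comap (Subtype.val : Bσ → _)),
          Nonempty (A ≃[L] FinApprox.QuotientAlgebra h) := by
  open FinApprox in
  open Filter Set Topology in
  have hinf : ℵ₀ ≤ lambda A := le_max_left _ _
  have hcard : #(lambda A).out = lambda A := mk_out _
  have : Infinite (lambda A).out := infinite_iff.2 (by rwa [hcard])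
  obtain ⟨ι, U, hU⟩ := exists_good_ultrafilter (lambda A).out
  -- The trivial family `P` extracts regularity of `U`.
  obtain ⟨q, hq, -⟩ := hU (fun _ => univ) fun _ => univ_mem
  obtain ⟨J, W, hJ, hW, hsymm, hcomp, hnhds⟩ := exists_small_entourages A
  obtain ⟨J', C, hJ', hC, hcov⟩ := exists_small_compacts hA
  obtain ⟨M, j, D, V, hM, hj, hne, hV, hD⟩ := exists_approximations hA happrox hq
    (hJ.trans hcard.ge) (hJ'.trans hcard.ge) hW hC
  refine ⟨ι, U, M, hM, fun X => hcard ▸ isSaturated_of_good hU X, ?_⟩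
  have hmap : ∀ {n : ℕ} (f : L.Functions n) {x : Fin n → UProd U fun i => M i} {a : Fin n → A},
      (∀ m, HasStandardPart j (x m) (a m)) →
        HasStandardPart j (FirstOrder.Language.Structure.funMap f x)
          (FirstOrder.Language.Structure.funMap f a) := fun f _ _ hx =>
    HasStandardPart.funMap hcont hW hcomp hnhds hcov (fun i => (hj i).1) hV hD f hx
  let B : L.Substructure (UProd U fun i => M i) :=
    { carrier := {x | ∃ a, HasStandardPart j x a}
      fun_mem := fun f x hx => by
        choose a ha using hx
        exact ⟨_, hmap f ha⟩ }
  choose st hst using fun x : B => x.2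
  let φ : B →[L] A :=
    { toFun := st
      map_fun' := fun f x => (hst _).unique (hmap f fun m => hst (x m))
      map_rel' := fun r => isEmptyElim r }
  have hφ : Function.Surjective φ := fun a => by
    obtain ⟨x, hx⟩ := exists_hasStandardPart (U := U) hW hcomp hnhds hcov
      (fun i => (hj i).2) hne hV hD a
    exact ⟨⟨x, a, hx⟩, (hst _).unique hx⟩
  have hker : ∀ x y : B, (infinitesimalSetoid (U := U) hW hsymm hcomp j).comap
      (Subtype.val : B → _) x y ↔ φ x = φ y := fun x y =>
    infinitesimalSetoid_iff hW hsymm hcomp hnhds (hst x) (hst y)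
  refine ⟨B, infinitesimalSetoid hW hsymm hcomp j, ?_,
    isPiRel_infinitesimalSetoid hW hsymm hcomp j hJ, isCongruence_of_hom φ hker,
    nonempty_equiv_quotientAlgebra φ hφ _ hker⟩
  exact ⟨J', _, hJ', fun k => isInternal_internalSet U _, setOf_hasStandardPart_eq hC hcov j⟩
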